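/- **Theorem (Euler–Lagrange equation for a gauge group field).** *Setting.* Let $M$ be a finite simplicial or cubical complex in a Euclidean space with a fixed linear ordering of the vertices; if $M$ is cubical, assume that the minimal and the maximal vertex of each $2$-dimensional face are opposite. Edges are directed from the smaller to the larger vertex. Let $a$ be the minimal and $c$ the maximal vertex of a $2$-face; write a triangle as $abc$ with $a<b<c$ and a square as $abcd$ with $a<b<d<c$. Denote by $C^k(M;W)=C_k(M;W)$ the set of $W$-valued functions on $k$-dimensional faces, where $W$ is a set. Let $G$ be a Lie group represented by unitary transformations of $\mathbb{C}^n$, the represented elements being regarded as matrices in $\mathbb{C}^{n\times n}$. On $\mathbb{C}^{n\times n}$ use the scalar product $\langle u,v\rangle=\mathrm{Re}\,\mathrm{Tr}(u^*v)$; let $T_uG\subset\mathbb{C}^{n\times n}$ be the real linear subspace parallel to the tangent space to $G$ at $u$ (the image of the differential of the representation) and let $\mathrm{Pr}_{T_uG}$ be the orthogonal projection onto it; $\mathrm{Pr}_{T_UG}$ is applied edgewise. For $U\in C^1(M;\mathbb{C}^{n\times n})$ let $A=U-1$, and let $F[U]\in C^2(M;\mathbb{C}^{n\times n})$ be the curvature: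 $F[U](abc)=U(ab)U(bc)-U(ac)$ on triangles, $F[U](abcd)=U(ab)U(bc)-U(ad)U(dc)$ on squares. For $\Phi\in C_2(M;\mathbb{C}^{n\times n})$ the covariant boundary is $$D_A^*\Phi=\partial\Phi+(\Phi^*\frown A)^*+(A\stackrel{*}{\frown}\Phi^*)^*\in C_1(M;\mathbb{C}^{n\times n}),$$ where $^*$ is the facewise conjugate transpose, $[\partial\Phi](e)=\sum_{f\supset e}[e:f]\,\Phi(f)$ with $[e:f]=+1$ for the sides $ab,bc$ and $[e:f]=-1$ for the other sides ($ac$ of a triangle, $ad$ and $dc$ of a square), and $$[\Psi\frown A](yz)=\sum_{x}\langle x,y,z\rangle\Psi(x\dots z)A(xy),\qquad [A\stackrel{*}{\frown}\Psi](xy)=\sum_{z}\langle x,y,z\rangle A(yz)\Psi(x\dots z),$$ the sums being over the $2$-faces $x\dots z$, with minimal vertex $x$ and maximal vertex $z$, that contain both edges $xy$ and $yz$, with $\langle a,b,c\rangle=+1$ and, in a square, $\langle a,d,c\rangle=-1$. A *local Lagrangian* is a function $\mathcal{L}\colon C^1(M;\mathbb{C}^{n\times n})\to C_0(M;\mathbb{R})$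 of the form $$\mathcal{L}[U](v)=L_v\bigl((U(e))_{\max e=v},\,(F[U](f))_{\max f=v}\bigr)$$ with $L_v$ differentiable for each vertex $v$, where $e$ and $f$ run over the edges and the $2$-faces with maximal vertex $v$. For a real function $\mathrm{f}$ of $z\in\mathbb{C}^{n\times n}$ put $(\partial \mathrm{f}/\partial z)_{lk}=\partial \mathrm{f}/\partial(\mathrm{Re}\,z_{kl})-i\,\partial \mathrm{f}/\partial(\mathrm{Im}\,z_{kl})$. Define $\frac{\partial\mathcal{L}[U]}{\partial U}\in C_1(M;\mathbb{C}^{n\times n})$ and $\frac{\partial\mathcal{L}[U]}{\partial(F[U])}\in C_2(M;\mathbb{C}^{n\times n})$ at an edge $e$ and a $2$-face $f$ as the partial derivatives in this sense of $L_{\max e}$ with respect to the argument $U(e)$ and of $L_{\max f}$ with respect to the argument $F[U](f)$, all other arguments of $L_v$ being fixed, evaluated at $U$, $F[U]$. *Statement.* Let $\mathcal{L}$ be a local Lagrangian and $\mathcal{S}[U]=\sum_v\mathcal{L}[U](v)$, the sum over all vertices. Then $U\in C^1(M;G)$ is stationary for $\mathcal{S}$ under the constraint $U\in C^1(M;G)$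 (that is, $\frac{d}{dt}\mathcal{S}[U_t]\big|_{t=0}=0$ for each family $U_t\in C^1(M;G)$ smooth in $t$ at $t=0$ with $U_0=U$) if and only if $$\mathrm{Pr}_{T_UG}\left[D_A^*\left(\frac{\partial\mathcal{L}[U]}{\partial(F[U])}\right)^*+\left(\frac{\partial\mathcal{L}[U]}{\partial U}\right)^*\right]=0 .$$ -/

import Mathlib

open scoped Manifold ContDiff Matrix

/-! ### Matrices with the scalar product `Re Tr (u* v)` -/

/-- Complex `n × n` matrices. -/
abbrev CMat (n : ℕ) : Type := Matrix (Fin n) (Fin n) ℂ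

attribute [local instance] Matrix.frobeniusNormedAddCommGroup

/-- The topology of the Frobenius norm. It is the usual topology of the space of matrices; the instance
only makes sure that the topology is found through the norm. -/
@[reducible] noncomputable def matrixNormTopology (n : ℕ) : TopologicalSpace (CMat n) :=
  (Matrix.frobeniusNormedAddCommGroup :
    NormedAddCommGroup (CMat n)).toPseudoMetricSpace.toUniformSpace.toTopologicalSpace

attribute [local instance] matrixNormTopology

/-- The real scalar product `⟨u, v⟩ = Re Tr (u* v)` on complex matrices; its norm is the Frobenius
norm. -/
@[reducible] noncomputable def traceInnerProductSpace (n : ℕ) : InnerProductSpace ℝ (CMat n) :=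
  { Matrix.frobeniusNormedSpace with
    inner := fun u v => (Matrix.trace (uᴴ * v)).re
    norm_sq_eq_re_inner := by
      intro u
      rw [Matrix.frobenius_norm_def, ← Real.sqrt_eq_rpow, Real.sq_sqrt (by positivity)]
      simp only [Matrix.trace, Matrix.diag, Matrix.mul_apply, Matrix.conjTranspose_apply,
        Complex.re_sum, RCLike.re_to_real]
      rw [Finset.sum_comm]
      refine Finset.sum_congr rfl fun i _ => Finset.sum_congr rfl fun j _ => ?_
      have h := Complex.normSq_eq_norm_sq (u j i)
      simp only [Complex.normSq_apply] at h
      simp only [Real.rpow_ofNat, Complex.star_def, Complex.mul_re, Complex.conj_re,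
        Complex.conj_im]
      linarith
    conj_inner_symm := by
      intro u v
      have h : (Matrix.trace (vᴴ * u)) = star (Matrix.trace (uᴴ * v)) := by
        rw [← Matrix.trace_conjTranspose, Matrix.conjTranspose_mul,
          Matrix.conjTranspose_conjTranspose]
      simp [h]
    add_left := by
      intro u v w
      simp [Matrix.conjTranspose_add, Matrix.add_mul, Matrix.trace_add]
    smul_left := by
      intro u v r
      simp [Matrix.conjTranspose_smul, Matrix.trace_smul] }

attribute [local instance] traceInnerProductSpace

/-- The orthogonal projection of the space of matrices onto a real linear subspace, with respect to
the scalar product `Re Tr (u* v)`. -/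
noncomputable def orthProj {n : ℕ} (T : Submodule ℝ (CMat n)) (u : CMat n) : CMat n :=
  T.starProjection u

/-- The matrix `∂f/∂z` of partial derivatives of a real function `f` of a complex matrix `z`:
`(∂f/∂z)_{lk} = ∂f/∂(Re z_{kl}) - i ∂f/∂(Im z_{kl})`. -/
noncomputable def matrixDeriv {n : ℕ} (f : CMat n → ℝ) (z : CMat n) : CMat n :=
  Matrix.of fun l k =>
    (fderiv ℝ f z (Matrix.single k l 1) : ℂ)
      - Complex.I * (fderiv ℝ f z (Matrix.single k l Complex.I) : ℂ)

/-! ### Spacetimes: finite simplicial or cubical complexes with ordered vertices -/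

/-- The two kinds of complexes: built of simplices or built of hypercubes. -/
inductive CellShape : Type
  | simplex
  | cube
  deriving DecidableEq

namespace CellShape

/-- The number of vertices of a `k`-dimensional cell. -/
def numVertices : CellShape → ℕ → ℕ
  | simplex, k => k + 1
  | cube, k => 2 ^ k

end CellShape

section Cells

variable {V : Type*} [LinearOrder V] {d : ℕ}

/-- The vertices `c S` of a `k`-dimensional hypercube in Euclidean space, indexed by the subsets `S`
of the set of directions: `c S` is the corner `p` shifted along the directions in `S`. The edge
vectors `u i` are orthogonal and have the same positive length. -/
def IsCubeMap (pos : V → EuclideanSpace ℝ (Fin d)) {k : ℕ} (c : Finset (Fin k) → V) : Prop :=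
  Function.Injective c ∧
  ∃ (p : EuclideanSpace ℝ (Fin d)) (u : Fin k → EuclideanSpace ℝ (Fin d)) (l : ℝ),
    0 < l ∧ (∀ i, ‖u i‖ = l) ∧ (∀ i j, i ≠ j → inner ℝ (u i) (u j) = 0) ∧
    ∀ S, pos (c S) = p + ∑ i ∈ S, u i

/-- `s` is the vertex set of a simplex, respectively of a hypercube. -/
def IsCell (pos : V → EuclideanSpace ℝ (Fin d)) : CellShape → Finset V → Prop
  | .simplex, s => s.Nonempty ∧ AffineIndependent ℝ (fun x : s => pos x)
  | .cube, s => ∃ (k : ℕ) (c : Finset (Fin k) → V), IsCubeMap pos c ∧ s = Finset.univ.image c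

/-- `t` is the vertex set of a (nonempty, not necessarily proper) face of the simplex, respectively
the hypercube, with the vertex set `s`. -/
def IsFaceOf (pos : V → EuclideanSpace ℝ (Fin d)) : CellShape → Finset V → Finset V → Prop
  | .simplex, t, s => t.Nonempty ∧ t ⊆ s
  | .cube, t, s => ∃ (k : ℕ) (c : Finset (Fin k) → V), IsCubeMap pos c ∧ s = Finset.univ.image c ∧
      ∃ A B : Finset (Fin k), A ⊆ B ∧ t = (Finset.Icc A B).image c

set_option synthInstance.maxSize 2000 in
theorem square_combinatorics : ∀ S T R : Finset (Fin 2), S ≠ T → T ≠ R → S ≠ R →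
    (symmDiff S R).card ≠ 1 → (symmDiff S T).card = 1 ∧ (symmDiff T R).card = 1 := by
  decide

theorem square_side : ∀ S T : Finset (Fin 2), (symmDiff S T).card = 1 →
    ({S, T} : Finset (Finset (Fin 2))) = Finset.Icc (S ∩ T) (S ∪ T) := by
  decide

theorem isFaceOf_square {pos : V → EuclideanSpace ℝ (Fin d)} {c : Finset (Fin 2) → V}
    (hc : IsCubeMap pos c) {S T : Finset (Fin 2)} (h : (symmDiff S T).card = 1) :
    IsFaceOf pos .cube {c S, c T} (Finset.univ.image c) := by
  refine ⟨2, c, hc, rfl, S ∩ T, S ∪ T, Finset.inter_subset_union, ?_⟩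
  rw [← square_side S T h, Finset.image_insert, Finset.image_singleton]

end Cells

/-- A spacetime: a finite simplicial or cubical complex in a Euclidean space, whose set of vertices
is the finite linearly ordered set `V` (placed into the Euclidean space by `pos`). Each cell is
given by its set of vertices. In a cubical complex, the minimal and the maximal vertex of each
square are opposite. -/
structure Spacetime (V : Type*) [Fintype V] [LinearOrder V] (d : ℕ) where
  shape : CellShape
  pos : V → EuclideanSpace ℝ (Fin d)
  pos_injective : Function.Injective pos
  cells : Finset (Finset V)
  singleton_mem : ∀ v : V, {v} ∈ cells
  isCell : ∀ s ∈ cells, IsCell pos shape s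
  face_mem : ∀ s ∈ cells, ∀ t, IsFaceOf pos shape t s → t ∈ cells
  /-- The intersection of two cells is either empty or their common face. -/
  inter_cells : ∀ s ∈ cells, ∀ t ∈ cells,
    convexHull ℝ (pos '' s) ∩ convexHull ℝ (pos '' t) = ∅ ∨
    ∃ r, IsFaceOf pos shape r s ∧ IsFaceOf pos shape r t ∧
      convexHull ℝ (pos '' s) ∩ convexHull ℝ (pos '' t) = convexHull ℝ (pos '' r)
  /-- Two distinct vertices of a square are opposite if and only if they do not form a side. -/
  opposite : shape = .cube → ∀ s ∈ cells, s.card = 4 → ∀ h : s.Nonempty,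
    ¬ IsFaceOf pos .cube {s.min' h, s.max' h} s

namespace Spacetime

variable {V : Type*} [Fintype V] [LinearOrder V] {d : ℕ} (M : Spacetime V d)

/-- The `k`-dimensional faces of the complex. -/
abbrev Cell (k : ℕ) : Type _ :=
  {s : Finset V // s ∈ M.cells ∧ s.card = M.shape.numVertices k}

variable {M}

theorem cell_nonempty {k : ℕ} (f : M.Cell k) : f.1.Nonempty := by
  rw [← Finset.card_pos, f.2.2]
  cases M.shape <;> simp [CellShape.numVertices]

/-- The minimal vertex of a face. -/
def minV {k : ℕ} (f : M.Cell k) : V := f.1.min' (cell_nonempty f)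

/-- The maximal vertex of a face. -/
def maxV {k : ℕ} (f : M.Cell k) : V := f.1.max' (cell_nonempty f)

/-- The vertices of a face besides the minimal and the maximal one. -/
def midV {k : ℕ} (f : M.Cell k) : Finset V := (f.1.erase (minV f)).erase (maxV f)

theorem minV_mem {k : ℕ} (f : M.Cell k) : minV f ∈ f.1 := Finset.min'_mem _ _

theorem maxV_mem {k : ℕ} (f : M.Cell k) : maxV f ∈ f.1 := Finset.max'_mem _ _

theorem two_lt_card (f : M.Cell 2) : 2 < f.1.card := by
  rw [f.2.2]
  cases M.shape <;> simp [CellShape.numVertices]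

theorem minV_ne_maxV (f : M.Cell 2) : minV f ≠ maxV f :=
  (Finset.min'_lt_max'_of_card f.1 (by have := two_lt_card f; omega)).ne

theorem midV_nonempty (f : M.Cell 2) : (midV f).Nonempty := by
  rw [← Finset.card_pos]
  have h1 := Finset.pred_card_le_card_erase (s := f.1) (a := minV f)
  have h2 := Finset.pred_card_le_card_erase (s := f.1.erase (minV f)) (a := maxV f)
  have h3 := two_lt_card f
  unfold midV
  omega

theorem cell_of_shape {sh : CellShape} (h : M.shape = sh) {s : Finset V} (hs : s ∈ M.cells) :
    IsCell M.pos sh s := h ▸ M.isCell s hs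

theorem face_of_shape {sh : CellShape} (h : M.shape = sh) {s t : Finset V} (hs : s ∈ M.cells)
    (ht : IsFaceOf M.pos sh t s) : t ∈ M.cells := M.face_mem s hs t (h.symm ▸ ht)

theorem sides_mem (f : M.Cell 2) {x : V} (hx : x ∈ midV f) :
    ({minV f, x} : Finset V) ∈ M.cells ∧ ({x, maxV f} : Finset V) ∈ M.cells := by
  have hx' := hx
  simp only [midV, Finset.mem_erase] at hx'
  obtain ⟨hxc, hxa, hxf⟩ := hx'
  have ha := minV_mem f
  have hc := maxV_mem f
  have hac := minV_ne_maxV f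
  cases hs : M.shape with
  | simplex =>
    exact ⟨face_of_shape hs f.2.1 ⟨by simp, by simp [Finset.insert_subset_iff, ha, hxf]⟩,
      face_of_shape hs f.2.1 ⟨by simp, by simp [Finset.insert_subset_iff, hc, hxf]⟩⟩
  | cube =>
    have hcard : f.1.card = 4 := by
      have h := f.2.2
      simp only [hs, CellShape.numVertices] at h
      exact h
    have hopp : ¬ IsFaceOf M.pos .cube {minV f, maxV f} f.1 :=
      M.opposite hs f.1 f.2.1 hcard (cell_nonempty f)
    obtain ⟨k, c, hcm, hfc⟩ := cell_of_shape hs f.2.1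
    have hk : k = 2 := by
      have h1 := hcard
      rw [hfc, Finset.card_image_of_injective _ hcm.1] at h1
      simp only [Finset.card_univ, Fintype.card_finset, Fintype.card_fin] at h1
      exact Nat.pow_right_injective (le_refl 2) (by simpa using h1)
    subst hk
    rw [hfc] at ha hc hxf
    obtain ⟨S, -, hS⟩ := Finset.mem_image.1 ha
    obtain ⟨T, -, hT⟩ := Finset.mem_image.1 hxf
    obtain ⟨R, -, hR⟩ := Finset.mem_image.1 hc
    have hSR : (symmDiff S R).card ≠ 1 := by
      intro h
      apply hopp
      have h' := isFaceOf_square hcm h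
      rwa [hS, hR, ← hfc] at h'
    obtain ⟨h1, h2⟩ := square_combinatorics S T R
      (by rintro rfl; exact hxa (hT.symm.trans hS)) (by rintro rfl; exact hxc (hT.symm.trans hR))
      (by rintro rfl; exact hac (hS.symm.trans hR)) hSR
    have h1' := isFaceOf_square hcm h1
    have h2' := isFaceOf_square hcm h2
    rw [hS, hT, ← hfc] at h1'
    rw [hT, hR, ← hfc] at h2'
    exact ⟨face_of_shape hs f.2.1 h1', face_of_shape hs f.2.1 h2'⟩

/-- The minimal vertex of a `2`-dimensional face besides `minV` and `maxV`. -/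
def lowV (f : M.Cell 2) : V := (midV f).min' (midV_nonempty f)

/-- The maximal vertex of a `2`-dimensional face besides `minV` and `maxV` (for a triangle, it
coincides with `lowV`). -/
def highV (f : M.Cell 2) : V := (midV f).max' (midV_nonempty f)

theorem lowV_mem (f : M.Cell 2) : lowV f ∈ midV f := Finset.min'_mem _ _

theorem highV_mem (f : M.Cell 2) : highV f ∈ midV f := Finset.max'_mem _ _

theorem numVertices_one (s : CellShape) : s.numVertices 1 = 2 := by cases s <;> rfl

/-- The edge joining the minimal vertex of a `2`-dimensional face to one of the middle vertices. -/
def fromMin (f : M.Cell 2) (x : V) (hx : x ∈ midV f) : M.Cell 1 :=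
  ⟨{minV f, x}, (sides_mem f hx).1, by
    rw [numVertices_one, Finset.card_pair]
    rintro h
    simp [midV, ← h] at hx⟩

/-- The edge joining one of the middle vertices of a `2`-dimensional face to its maximal vertex. -/
def toMax (f : M.Cell 2) (x : V) (hx : x ∈ midV f) : M.Cell 1 :=
  ⟨{x, maxV f}, (sides_mem f hx).2, by
    rw [numVertices_one, Finset.card_pair]
    rintro h
    simp [midV, h] at hx⟩

/-- The edge joining the minimal and the maximal vertex of a triangle. -/
def longEdge (h : M.shape = .simplex) (f : M.Cell 2) : M.Cell 1 :=
  ⟨{minV f, maxV f}, face_of_shape h f.2.1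
      ⟨by simp, by simp [Finset.insert_subset_iff, minV_mem f, maxV_mem f]⟩, by
    rw [numVertices_one, Finset.card_pair (minV_ne_maxV f)]⟩

/-! The sides of a `2`-dimensional face. A square is denoted `abcd` and a triangle `abc`, where `a`
is the minimal vertex, `c` is the maximal vertex, and `a < b < d < c` for a square. Thus `(ab, ad)`
is a positive basis of a square and `(ab, ac)` is a positive basis of a triangle. For a triangle
`sideAD = sideAB` and `sideDC = sideBC`. -/

/-- The side `ab`. -/
def sideAB (f : M.Cell 2) : M.Cell 1 := fromMin f (lowV f) (lowV_mem f)

/-- The side `bc`. -/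
def sideBC (f : M.Cell 2) : M.Cell 1 := toMax f (lowV f) (lowV_mem f)

/-- The side `ad`. -/
def sideAD (f : M.Cell 2) : M.Cell 1 := fromMin f (highV f) (highV_mem f)

/-- The side `dc`. -/
def sideDC (f : M.Cell 2) : M.Cell 1 := toMax f (highV f) (highV_mem f)

/-! ### Cochains and operations on them -/

variable (M) in
/-- Matrix-valued functions on `k`-dimensional faces (chains and cochains are not distinguished). -/
abbrev Cochain (k n : ℕ) : Type _ := M.Cell k → CMat n

/-- Coorientation of an edge `e` with a `2`-dimensional face `f`: the sign of the basis formed by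
the outer normal to `e` in `f` and the vector of `e` (directed from the minimal vertex to the
maximal one) with respect to the positive basis in `f`. It is `+1` for the sides `ab` and `bc`,
and `-1` for the other sides (`ac` of a triangle, `ad` and `dc` of a square); it is set to be `0` if
`e` is not a side of `f`. -/
def incidence (e : M.Cell 1) (f : M.Cell 2) : ℤ :=
  if e = sideAB f ∨ e = sideBC f then 1
  else if h : M.shape = .simplex then (if e = longEdge h f then -1 else 0)
  else if e = sideAD f ∨ e = sideDC f then -1
  else 0

/-- The sign `⟨x, y, z⟩` for edges `e₁ = xy` and `e₂ = yz` and a `2`-dimensional face `f` with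
minimal vertex `x` and maximal vertex `z` containing both edges: the sign of the basis `(xy, yz)` with
respect to the positive basis in `f`. It is `+1` for `(ab, bc)` (checked first, so it is the only case for a
triangle, where `ad = ab` and `dc = bc`), and `-1` for `(ad, dc)` in a square. It is set to be `0` if the edges and the face do not form such a triple. -/
def tripleSign (e₁ e₂ : M.Cell 1) (f : M.Cell 2) : ℤ :=
  if e₁ = sideAB f ∧ e₂ = sideBC f then 1
  else if e₁ = sideAD f ∧ e₂ = sideDC f then -1
  else 0

variable {n : ℕ}

/-- Pointwise conjugate transpose. -/
def adj {k : ℕ} (Φ : M.Cochain k n) : M.Cochain k n := fun f => (Φ f)ᴴ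

/-- The boundary of a function on `2`-dimensional faces. -/
def boundary (Φ : M.Cochain 2 n) : M.Cochain 1 n := fun e => ∑ f, incidence e f • Φ f

/-- The cap-product
`[Φ ⌢ Ψ](y…z) = ∑ ⟨x, y, z⟩ Φ(x…z) Ψ(x…y)` of functions on `2`-faces and edges. -/
def cap (Φ : M.Cochain 2 n) (Ψ : M.Cochain 1 n) : M.Cochain 1 n := fun e₂ =>
  ∑ f, ∑ e₁, tripleSign e₁ e₂ f • (Φ f * Ψ e₁)

/-- The cop-product
`[Φ ⌢* Ψ](x…y) = ∑ ⟨x, y, z⟩ Φ(y…z) Ψ(x…z)` of functions on edges and `2`-faces. -/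
def cop (Φ : M.Cochain 1 n) (Ψ : M.Cochain 2 n) : M.Cochain 1 n := fun e₁ =>
  ∑ f, ∑ e₂, tripleSign e₁ e₂ f • (Φ e₂ * Ψ f)

/-- The connection `A[U] = U - 1`. -/
def connection (U : M.Cochain 1 n) : M.Cochain 1 n := fun e => U e - 1

/-- The curvature: `F[U](abcd) = U(ab) U(bc) - U(ad) U(dc)` for a square and
`F[U](abc) = U(ab) U(bc) - U(ac)` for a triangle. -/
def curvature (U : M.Cochain 1 n) : M.Cochain 2 n := fun f =>
  if h : M.shape = .simplex then U (sideAB f) * U (sideBC f) - U (longEdge h f)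
  else U (sideAB f) * U (sideBC f) - U (sideAD f) * U (sideDC f)

/-- The covariant boundary `D*_A Φ = ∂Φ + (Φ* ⌢ A)* + (-1)^k (A ⌢* Φ*)*` for `k = 2`. -/
def covBoundary (A : M.Cochain 1 n) (Φ : M.Cochain 2 n) : M.Cochain 1 n :=
  boundary Φ + adj (cap (adj Φ) A) + (-1 : ℤ) ^ 2 • adj (cop A (adj Φ))

variable (M n) in
/-- A local Lagrangian: the value at a vertex `v` is a differentiable function `L_v` of the values of
`U` and `F[U]` at the edges and the `2`-dimensional faces for which `v` is the maximal vertex. -/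
structure LocalLagrangian where
  toFun : M.Cochain 1 n → V → ℝ
  density : ∀ v : V,
    ({e : M.Cell 1 // maxV e = v} → CMat n) × ({f : M.Cell 2 // maxV f = v} → CMat n) → ℝ
  differentiable_density : ∀ v, Differentiable ℝ (density v)
  toFun_eq : ∀ U v, toFun U v = density v (fun e => U e.1, fun f => curvature U f.1)

namespace LocalLagrangian

variable (𝓛 : LocalLagrangian M n)

/-- The action `ε 𝓛[U]`: the sum of the values of the Lagrangian over all vertices. -/
def action (U : M.Cochain 1 n) : ℝ := ∑ v, 𝓛.toFun U v

/-- The partial derivative of the Lagrangian with respect to `U`. -/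
noncomputable def derivField (U : M.Cochain 1 n) : M.Cochain 1 n := fun e =>
  matrixDeriv (fun z => 𝓛.density (maxV e)
    (Function.update (fun e' => U e'.1) ⟨e, rfl⟩ z, fun f' => curvature U f'.1)) (U e)

/-- The partial derivative of the Lagrangian with respect to `F[U]`. -/
noncomputable def derivCurvature (U : M.Cochain 1 n) : M.Cochain 2 n := fun f =>
  matrixDeriv (fun z => 𝓛.density (maxV f)
    (fun e' => U e'.1, Function.update (fun f' => curvature U f'.1) ⟨f, rfl⟩ z)) (curvature U f)

end LocalLagrangian

end Spacetime

/-! ### Gauge groups -/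

section Gauge

variable {E : Type*} [NormedAddCommGroup E] [NormedSpace ℝ E] {G : Type*} [TopologicalSpace G]
  [ChartedSpace E G] [Group G] {n : ℕ}

/-- The subspace `T_u G` of the space of matrices for a group `G` represented by unitary matrices
and `u = ρ g`: the image of the tangent space to `G` at `g`. -/
noncomputable def gaugeTangent (ρ : G →* Matrix.unitaryGroup (Fin n) ℂ) (g : G) :
    Submodule ℝ (CMat n) :=
  let D : E →L[ℝ] CMat n := mfderiv 𝓘(ℝ, E) 𝓘(ℝ, CMat n) (fun x : G => (ρ x : CMat n)) g
  LinearMap.range D.toLinearMap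

/-- The matrix-valued function given by a function with values in the represented group `G`. -/
def gaugeField {X : Type*} (ρ : G →* Matrix.unitaryGroup (Fin n) ℂ) (U : X → G) : X → CMat n :=
  fun x => (ρ (U x) : CMat n)

/-- `U : X → G` is stationary for the functional `S` under the constraint that the values of the
field lie in `G`: along each smooth variation of `U` among the `G`-valued functions, the derivative of
the functional vanishes. -/
def IsStationaryOn {X : Type*} (ρ : G →* Matrix.unitaryGroup (Fin n) ℂ)
    (S : (X → CMat n) → ℝ) (U : X → G) : Prop :=
  ∀ γ : ℝ → X → G, γ 0 = U →
    (∀ x, ContMDiffAt 𝓘(ℝ, ℝ) 𝓘(ℝ, E) ∞ (fun t => γ t x) 0) →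
    HasDerivAt (fun t => S (gaugeField ρ (γ t))) 0 0

end Gauge

/-! Let `U` move in `G` with edge velocities `δ e`, each in the tangent space at `U e`. By the chain
rule, the derivative of the action is a sum over edges of Re Tr(∂L/∂U · δ) plus a sum over faces of
Re Tr(∂L/∂F · δF). Here every edge and every face occurs exactly once, because it has a single
maximal vertex (`sum_sum_fiber`).

The Leibniz rule makes δF linear in δ, e.g. δ(ab)U(bc) + U(ab)δ(bc) - δ(ac) on a triangle. Cyclicity
of the trace moves this map to the other factor, and writing U = 1 + A identifies its adjoint with
the covariant boundary: the unit parts give the boundary, and the A parts give the two products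
(`sum_trace_covBoundary`). So the first variation is the sum over edges of ⟨gradient, δ⟩
(`hasDerivAt_action`).

Velocities on different edges are independent, and every tangent vector is the velocity of a smooth
curve (`exists_contMDiffAt_curve`). Hence stationarity means that the gradient at each edge is
orthogonal to the tangent space, i.e. has zero projection. -/

/-! ### Calculus of functions of matrices and of tuples of matrices -/

/-- The derivative of a real function in terms of the matrix of its partial derivatives. -/
theorem fderiv_apply_eq_re_trace {n : ℕ} (f : CMat n → ℝ) (z w : CMat n) :
    fderiv ℝ f z w = (Matrix.trace (matrixDeriv f z * w)).re := by
  -- Real basis E_kl, iE_kl. The transposed indices in `matrixDeriv` then turn the sum into a trace,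
  -- since Re((a - ib)(x + iy)) = ax + by.
  have key : w = ∑ k, ∑ l, ((w k l).re • Matrix.single k l (1 : ℂ)
      + (w k l).im • Matrix.single k l Complex.I) := by
    conv_lhs => rw [Matrix.matrix_eq_sum_single w]
    refine Finset.sum_congr rfl fun k _ => Finset.sum_congr rfl fun l _ => ?_
    rw [Matrix.smul_single, Matrix.smul_single, ← Matrix.single_add]
    congr 1
    apply Complex.ext <;> simp
  conv_lhs => rw [key]
  simp only [map_sum, map_add, map_smul, smul_eq_mul]
  simp only [Matrix.trace, Matrix.diag, Matrix.mul_apply, Complex.re_sum, matrixDeriv,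
    Matrix.of_apply]
  rw [Finset.sum_comm]
  refine Finset.sum_congr rfl fun l _ => Finset.sum_congr rfl fun k _ => ?_
  simp [Complex.mul_re]
  ring

theorem HasDerivAt.matrix_mul {n : ℕ} {u v : ℝ → CMat n} {u' v' : CMat n} {t : ℝ}
    (hu : HasDerivAt u u' t) (hv : HasDerivAt v v' t) :
    HasDerivAt (fun s => u s * v s) (u' * v t + u t * v') t := by
  -- Multiplication is bilinear, hence continuous in finite dimension; no submultiplicativity of the
  -- norm is needed.
  let B : CMat n →L[ℝ] CMat n →L[ℝ] CMat n :=
    LinearMap.toContinuousLinearMap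
      (LinearMap.toContinuousLinearMap.toLinearMap ∘ₗ (LinearMap.mul ℝ (CMat n)))
  have h := B.hasDerivAt_of_bilinear (𝕜 := ℝ) (fun _ => hu) (fun _ => hv)
  rw [add_comm]
  exact h

/-- Replacing one coordinate is an affine map with linear part `Pi.single i`. This links the partial
derivatives in `derivField` to the total derivative of the density. -/
theorem fderiv_comp_update_fst {ι F H : Type*} [Fintype ι] [DecidableEq ι]
    [NormedAddCommGroup F] [NormedSpace ℝ F] [NormedAddCommGroup H] [NormedSpace ℝ H]
    {g : (ι → F) × H → ℝ} {x : ι → F} {y : H} (hg : DifferentiableAt ℝ g (x, y)) (i : ι) (w : F) :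
    fderiv ℝ (fun z => g (Function.update x i z, y)) (x i) w
      = fderiv ℝ g (x, y) (Pi.single i w, 0) := by
  have h1 : HasFDerivAt (fun z => (Function.update x i z, y))
      ((ContinuousLinearMap.pi (Pi.single i (ContinuousLinearMap.id ℝ F))).prod 0) (x i) :=
    (hasFDerivAt_update x (x i)).prodMk (hasFDerivAt_const y _)
  have h2 : HasFDerivAt g (fderiv ℝ g (x, y)) (Function.update x i (x i), y) := by
    rw [Function.update_eq_self]
    exact hg.hasFDerivAt
  have h3 : HasFDerivAt (fun z => g (Function.update x i z, y)) _ (x i) := h2.comp (x i) h1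
  rw [h3.fderiv]
  simp only [ContinuousLinearMap.comp_apply, ContinuousLinearMap.prod_apply]
  congr 2
  ext j
  by_cases hj : j = i
  · subst hj; simp
  · simp [hj]

theorem fderiv_comp_update_snd {ι F H : Type*} [Fintype ι] [DecidableEq ι]
    [NormedAddCommGroup F] [NormedSpace ℝ F] [NormedAddCommGroup H] [NormedSpace ℝ H]
    {g : H × (ι → F) → ℝ} {x : ι → F} {y : H} (hg : DifferentiableAt ℝ g (y, x)) (i : ι) (w : F) :
    fderiv ℝ (fun z => g (y, Function.update x i z)) (x i) w
      = fderiv ℝ g (y, x) (0, Pi.single i w) := by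
  have h1 : HasFDerivAt (fun z => (y, Function.update x i z))
      ((0 : F →L[ℝ] H).prod (ContinuousLinearMap.pi (Pi.single i (ContinuousLinearMap.id ℝ F))))
      (x i) :=
    (hasFDerivAt_const y _).prodMk (hasFDerivAt_update x (x i))
  have h2 : HasFDerivAt g (fderiv ℝ g (y, x)) (y, Function.update x i (x i)) := by
    rw [Function.update_eq_self]
    exact hg.hasFDerivAt
  have h3 : HasFDerivAt (fun z => g (y, Function.update x i z)) _ (x i) := h2.comp (x i) h1
  rw [h3.fderiv]
  simp only [ContinuousLinearMap.comp_apply, ContinuousLinearMap.prod_apply]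
  congr 2
  ext j
  by_cases hj : j = i
  · subst hj; simp
  · simp [hj]

/-- A linear functional on a product of two finite powers is the sum of its partial ones. -/
theorem map_prod_pi_eq_sum {ι κ F : Type*} [Fintype ι] [DecidableEq ι] [Fintype κ] [DecidableEq κ]
    [NormedAddCommGroup F] [NormedSpace ℝ F] (ℓ : (ι → F) × (κ → F) →L[ℝ] ℝ)
    (x : ι → F) (y : κ → F) :
    ℓ (x, y) = ∑ i, ℓ (Pi.single i (x i), 0) + ∑ j, ℓ (0, Pi.single j (y j)) := by
  have hx : ((x, 0) : (ι → F) × (κ → F)) = ∑ i, (Pi.single i (x i), 0) := by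
    rw [Prod.ext_iff, Prod.fst_sum, Prod.snd_sum]
    simp [Finset.univ_sum_single]
  have hy : ((0, y) : (ι → F) × (κ → F)) = ∑ j, (0, Pi.single j (y j)) := by
    rw [Prod.ext_iff, Prod.fst_sum, Prod.snd_sum]
    simp [Finset.univ_sum_single]
  rw [← map_sum, ← map_sum, ← hx, ← hy, ← map_add]
  simp

/-- Applied to `maxV`: it merges the local sums at the vertices into sums over all edges or all
faces. -/
theorem sum_sum_fiber {α β N : Type*} [Fintype α] [Fintype β] [DecidableEq β] [AddCommMonoid N]
    (m : α → β) (h : α → N) : ∑ b, ∑ a : {a // m a = b}, h a.1 = ∑ a, h a := by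
  rw [← Fintype.sum_sigma']
  exact (Equiv.sigmaFiberEquiv m).sum_comp h

/-- Puts the projected equation into the form tested by variations: orthogonality to each tangent
vector. -/
theorem orthProj_eq_zero_iff {n : ℕ} (T : Submodule ℝ (CMat n)) (u : CMat n) :
    orthProj T u = 0 ↔ ∀ w ∈ T, (Matrix.trace (uᴴ * w)).re = 0 := by
  unfold orthProj
  rw [Submodule.starProjection_apply_eq_zero_iff, Submodule.mem_orthogonal']
  rfl

/-! ### Velocities of curves in a manifold -/

section Curves

variable {E : Type*} [NormedAddCommGroup E] [NormedSpace ℝ E] {G : Type*} [TopologicalSpace G]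
  [ChartedSpace E G] {F : Type*} [NormedAddCommGroup F] [NormedSpace ℝ F]

/-- The velocity of the image of a smooth curve lies in the image of the tangent space. -/
theorem exists_hasDerivAt_comp_curve {φ : G → F} {c : ℝ → G} {t : ℝ}
    (hφ : MDifferentiableAt 𝓘(ℝ, E) 𝓘(ℝ, F) φ (c t))
    (hc : MDifferentiableAt 𝓘(ℝ, ℝ) 𝓘(ℝ, E) c t) :
    ∃ v : E, HasDerivAt (fun s => φ (c s)) ((mfderiv 𝓘(ℝ, E) 𝓘(ℝ, F) φ (c t) : E →L[ℝ] F) v) t := by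
  have h := hφ.hasMFDerivAt.comp t hc.hasMFDerivAt
  -- Tangent spaces are definitionally the model spaces; with plain linear maps the velocity is the
  -- image of 1 ∈ ℝ.
  have key : ∀ (L : E →L[ℝ] F) (K : ℝ →L[ℝ] E), HasFDerivAt (fun s => φ (c s)) (L.comp K) t →
      ∃ v : E, HasDerivAt (fun s => φ (c s)) (L v) t := fun L K hLK => ⟨K 1, hLK.hasDerivAt⟩
  exact key _ (mfderiv 𝓘(ℝ, ℝ) 𝓘(ℝ, E) c t) (hasMFDerivAt_iff_hasFDerivAt.1 h)

/-- Each tangent vector is realized by a curve, linear in a chart. -/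
theorem exists_contMDiffAt_curve [IsManifold 𝓘(ℝ, E) ∞ G] {φ : G → F} {g : G}
    (hφ : MDifferentiableAt 𝓘(ℝ, E) 𝓘(ℝ, F) φ g) (v : E) :
    ∃ c : ℝ → G, c 0 = g ∧ ContMDiffAt 𝓘(ℝ, ℝ) 𝓘(ℝ, E) ∞ c 0 ∧
      HasDerivAt (fun s => φ (c s)) ((mfderiv 𝓘(ℝ, E) 𝓘(ℝ, F) φ g : E →L[ℝ] F) v) 0 := by
  have hline : HasDerivAt (fun t : ℝ => extChartAt 𝓘(ℝ, E) g g + t • v) v 0 := by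
    simpa using ((hasDerivAt_id (0 : ℝ)).smul_const v).const_add (extChartAt 𝓘(ℝ, E) g g)
  refine ⟨fun t => (extChartAt 𝓘(ℝ, E) g).symm (extChartAt 𝓘(ℝ, E) g g + t • v), by simp, ?_, ?_⟩
  · have h1 : ContMDiffAt 𝓘(ℝ, E) 𝓘(ℝ, E) ∞ (extChartAt 𝓘(ℝ, E) g).symm
        (extChartAt 𝓘(ℝ, E) g g + (0 : ℝ) • v) := by
      rw [zero_smul, add_zero]
      exact (contMDiffOn_extChartAt_symm g).contMDiffAt (extChartAt_target_mem_nhds g)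
    refine h1.comp (0 : ℝ) ?_
    exact ContDiffAt.contMDiffAt (by fun_prop)
  -- The model has full range, so `mfderiv` is the ordinary derivative of φ read in the chart at
  -- `g`. The base point is then rewritten as the value of the line at time 0.
  · have h := hφ.hasMFDerivAt.2
    simp only [writtenInExtChartAt, extChartAt_model_space_eq_id, modelWithCornersSelf_coe,
      Set.range_id] at h
    have h' : HasFDerivAt (φ ∘ (extChartAt 𝓘(ℝ, E) g).symm)
        (mfderiv 𝓘(ℝ, E) 𝓘(ℝ, F) φ g : E →L[ℝ] F)
        (extChartAt 𝓘(ℝ, E) g g + (0 : ℝ) • v) := by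
      rw [zero_smul, add_zero]
      exact h.hasFDerivAt Filter.univ_mem
    exact h'.comp_hasDerivAt (0 : ℝ) hline

end Curves
-- Combinatorics of the sides of a face
namespace Spacetime

variable {V : Type*} [Fintype V] [LinearOrder V] {d : ℕ} {M : Spacetime V d} {n : ℕ}

theorem minV_not_mem_midV (f : M.Cell 2) : minV f ∉ midV f := by simp [midV]

theorem maxV_not_mem_midV (f : M.Cell 2) : maxV f ∉ midV f := by simp [midV]

theorem fromMin_ne_toMax (f : M.Cell 2) {x y : V} (hx : x ∈ midV f) (hy : y ∈ midV f) :
    fromMin f x hx ≠ toMax f y hy := by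
  intro h
  have h1 : minV f ∈ ({y, maxV f} : Finset V) := by
    rw [← show (fromMin f x hx).1 = {y, maxV f} from congrArg Subtype.val h]
    simp [fromMin]
  rw [Finset.mem_insert, Finset.mem_singleton] at h1
  rcases h1 with h1 | h1
  · exact minV_not_mem_midV f (h1 ▸ hy)
  · exact minV_ne_maxV f h1

theorem fromMin_injective (f : M.Cell 2) {x y : V} (hx : x ∈ midV f) (hy : y ∈ midV f)
    (h : fromMin f x hx = fromMin f y hy) : x = y := by
  have h1 : x ∈ ({minV f, y} : Finset V) := by
    rw [← show (fromMin f x hx).1 = {minV f, y} from congrArg Subtype.val h]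
    simp [fromMin]
  rw [Finset.mem_insert, Finset.mem_singleton] at h1
  exact h1.resolve_left fun h2 => minV_not_mem_midV f (h2 ▸ hx)

theorem toMax_injective (f : M.Cell 2) {x y : V} (hx : x ∈ midV f) (hy : y ∈ midV f)
    (h : toMax f x hx = toMax f y hy) : x = y := by
  have h1 : x ∈ ({y, maxV f} : Finset V) := by
    rw [← show (toMax f x hx).1 = {y, maxV f} from congrArg Subtype.val h]
    simp [toMax]
  rw [Finset.mem_insert, Finset.mem_singleton] at h1
  exact h1.resolve_right fun h2 => maxV_not_mem_midV f (h2 ▸ hx)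

theorem longEdge_ne_fromMin (h : M.shape = .simplex) (f : M.Cell 2) {x : V} (hx : x ∈ midV f) :
    longEdge h f ≠ fromMin f x hx := by
  intro he
  have h1 : x ∈ ({minV f, maxV f} : Finset V) := by
    rw [show ({minV f, maxV f} : Finset V) = (fromMin f x hx).1 from congrArg Subtype.val he]
    simp [fromMin]
  rw [Finset.mem_insert, Finset.mem_singleton] at h1
  rcases h1 with rfl | rfl
  · exact minV_not_mem_midV f hx
  · exact maxV_not_mem_midV f hx

theorem longEdge_ne_toMax (h : M.shape = .simplex) (f : M.Cell 2) {x : V} (hx : x ∈ midV f) :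
    longEdge h f ≠ toMax f x hx := by
  intro he
  have h1 : x ∈ ({minV f, maxV f} : Finset V) := by
    rw [show ({minV f, maxV f} : Finset V) = (toMax f x hx).1 from congrArg Subtype.val he]
    simp [toMax]
  rw [Finset.mem_insert, Finset.mem_singleton] at h1
  rcases h1 with rfl | rfl
  · exact minV_not_mem_midV f hx
  · exact maxV_not_mem_midV f hx

theorem card_midV (f : M.Cell 2) : (midV f).card = f.1.card - 2 := by
  rw [midV, Finset.card_erase_of_mem, Finset.card_erase_of_mem (minV_mem f)]
  · omega
  · exact Finset.mem_erase.2 ⟨(minV_ne_maxV f).symm, maxV_mem f⟩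

theorem lowV_eq_highV (h : M.shape = .simplex) (f : M.Cell 2) : lowV f = highV f := by
  have hc : (midV f).card = 1 := by
    rw [card_midV, f.2.2, h]; rfl
  obtain ⟨x, hx⟩ := Finset.card_eq_one.1 hc
  have h1 := lowV_mem f
  have h2 := highV_mem f
  rw [hx, Finset.mem_singleton] at h1 h2
  rw [h1, h2]

theorem lowV_ne_highV (h : M.shape ≠ .simplex) (f : M.Cell 2) : lowV f ≠ highV f := by
  have hs : M.shape = .cube := by
    cases hs : M.shape
    · exact absurd hs h
    · rfl
  have hc : 1 < (midV f).card := by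
    rw [card_midV, f.2.2, hs]; decide
  exact (Finset.min'_lt_max'_of_card _ hc).ne

theorem sideAB_eq_sideAD (h : M.shape = .simplex) (f : M.Cell 2) : sideAB f = sideAD f := by
  simp only [sideAB, sideAD, lowV_eq_highV h f]

theorem sideBC_eq_sideDC (h : M.shape = .simplex) (f : M.Cell 2) : sideBC f = sideDC f := by
  simp only [sideBC, sideDC, lowV_eq_highV h f]

theorem sideAB_ne_sideAD (h : M.shape ≠ .simplex) (f : M.Cell 2) : sideAB f ≠ sideAD f :=
  fun he => lowV_ne_highV h f (fromMin_injective f _ _ he)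

theorem sideBC_ne_sideDC (h : M.shape ≠ .simplex) (f : M.Cell 2) : sideBC f ≠ sideDC f :=
  fun he => lowV_ne_highV h f (toMax_injective f _ _ he)

/-- The sides are pairwise distinct, so the case distinction is a signed sum of indicators, and sums
over edges collapse to the sides. -/
theorem incidence_simplex (h : M.shape = .simplex) (e : M.Cell 1) (f : M.Cell 2) :
    incidence e f = (if e = sideAB f then 1 else 0) + (if e = sideBC f then 1 else 0)
      - (if e = longEdge h f then 1 else 0) := by
  have h1 : sideAB f ≠ sideBC f := fromMin_ne_toMax f _ _
  have h2 : longEdge h f ≠ sideAB f := longEdge_ne_fromMin h f _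
  have h3 : longEdge h f ≠ sideBC f := longEdge_ne_toMax h f _
  unfold incidence
  rw [dif_pos h]
  grind

theorem incidence_cube (h : M.shape ≠ .simplex) (e : M.Cell 1) (f : M.Cell 2) :
    incidence e f = (if e = sideAB f then 1 else 0) + (if e = sideBC f then 1 else 0)
      - (if e = sideAD f then 1 else 0) - (if e = sideDC f then 1 else 0) := by
  have h1 : sideAB f ≠ sideBC f := fromMin_ne_toMax f _ _
  have h2 : sideAD f ≠ sideBC f := fromMin_ne_toMax f _ _
  have h3 : sideAB f ≠ sideDC f := fromMin_ne_toMax f _ _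
  have h4 : sideAD f ≠ sideDC f := fromMin_ne_toMax f _ _
  have h5 := sideAB_ne_sideAD h f
  have h6 := sideBC_ne_sideDC h f
  unfold incidence
  rw [dif_neg h]
  grind

/-- The branch with sign -1 never occurs: in a triangle ad = ab and dc = bc. The nested conditions
let the sum over each edge collapse separately. -/
theorem tripleSign_simplex (h : M.shape = .simplex) (e₁ e₂ : M.Cell 1) (f : M.Cell 2) :
    tripleSign e₁ e₂ f = if e₁ = sideAB f then if e₂ = sideBC f then 1 else 0 else 0 := by
  unfold tripleSign
  rw [← sideAB_eq_sideAD h, ← sideBC_eq_sideDC h]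
  grind

theorem tripleSign_cube (h : M.shape ≠ .simplex) (e₁ e₂ : M.Cell 1) (f : M.Cell 2) :
    tripleSign e₁ e₂ f = (if e₁ = sideAB f then if e₂ = sideBC f then 1 else 0 else 0)
      - (if e₁ = sideAD f then if e₂ = sideDC f then 1 else 0 else 0) := by
  have h5 := sideAB_ne_sideAD h f
  unfold tripleSign
  grind

/-! ### Variation of the curvature and its adjoint -/

/-- The derivative of the curvature at `U` in the direction `δ`. -/
def curvatureVariation (U δ : M.Cochain 1 n) : M.Cochain 2 n := fun f =>
  if h : M.shape = .simplex then
    δ (sideAB f) * U (sideBC f) + U (sideAB f) * δ (sideBC f) - δ (longEdge h f)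
  else
    δ (sideAB f) * U (sideBC f) + U (sideAB f) * δ (sideBC f)
      - (δ (sideAD f) * U (sideDC f) + U (sideAD f) * δ (sideDC f))

theorem hasDerivAt_curvature {u : ℝ → M.Cochain 1 n} {δ : M.Cochain 1 n} {t : ℝ}
    (hu : ∀ e, HasDerivAt (fun s => u s e) (δ e) t) (f : M.Cell 2) :
    HasDerivAt (fun s => curvature (u s) f) (curvatureVariation (u t) δ f) t := by
  unfold curvature curvatureVariation
  split_ifs with h
  · exact ((hu _).matrix_mul (hu _)).sub (hu _)
  · exact ((hu _).matrix_mul (hu _)).sub ((hu _).matrix_mul (hu _))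

/-- The covariant boundary is adjoint to the derivative of the curvature. -/
theorem sum_trace_covBoundary (U δ : M.Cochain 1 n) (P : M.Cochain 2 n) :
    ∑ e, Matrix.trace ((covBoundary (connection U) (adj P) e)ᴴ * δ e)
      = ∑ f, Matrix.trace (P f * curvatureVariation U δ f) := by
  -- All conjugate transposes cancel in pairs; A stands to the right of P in the cap term and to the
  -- left in the cop term.
  have hexp : ∀ e, Matrix.trace ((covBoundary (connection U) (adj P) e)ᴴ * δ e)
      = ∑ f, (incidence e f • Matrix.trace (P f * δ e)
        + ∑ e₁, tripleSign e₁ e f • Matrix.trace (P f * connection U e₁ * δ e)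
        + ∑ e₂, tripleSign e e₂ f • Matrix.trace (connection U e₂ * P f * δ e)) := by
    intro e
    simp [covBoundary, boundary, cap, cop, adj, Matrix.conjTranspose_sum, Matrix.add_mul,
      Finset.sum_mul, Matrix.trace_sum, Finset.sum_add_distrib, Matrix.trace_add,
      Matrix.trace_smul, -zsmul_eq_mul]
  simp only [hexp]
  -- With the face sum outside, the identity is checked on a single face.
  rw [Finset.sum_comm]
  refine Finset.sum_congr rfl fun f _ => ?_
  by_cases h : M.shape = .simplex
  · simp only [incidence_simplex h, tripleSign_simplex h, curvatureVariation, dif_pos h,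
      Finset.sum_add_distrib, sub_smul, add_smul, ite_smul, one_smul, zero_smul,
      Finset.sum_sub_distrib, Finset.sum_ite_eq', Finset.mem_univ, if_true, connection,
      Matrix.mul_sub, Matrix.sub_mul, Matrix.mul_add, Matrix.trace_add, Matrix.trace_sub,
      mul_one, one_mul, Finset.sum_ite_irrel, Finset.sum_const_zero]
    -- Tr(P δ(ab) U(bc)) = Tr(U(bc) P δ(ab)) matches the cop term. The -1 in A = U - 1 cancels the
    -- boundary terms at ab and bc, leaving only the one at ac.
    rw [← Matrix.mul_assoc, ← Matrix.mul_assoc, Matrix.trace_mul_cycle (P f) (δ _) (U _)]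
    ring
  · simp only [incidence_cube h, tripleSign_cube h, curvatureVariation, dif_neg h,
      Finset.sum_add_distrib, sub_smul, add_smul, ite_smul, one_smul, zero_smul,
      Finset.sum_sub_distrib, Finset.sum_ite_eq', Finset.mem_univ, if_true, connection,
      Matrix.mul_sub, Matrix.sub_mul, Matrix.mul_add, Matrix.trace_add, Matrix.trace_sub,
      mul_one, one_mul, Finset.sum_ite_irrel, Finset.sum_const_zero]
    simp only [← Matrix.mul_assoc]
    -- One rotation for each path, abc and adc; here all four boundary terms cancel.
    rw [Matrix.trace_mul_cycle (P f) (δ _) (U _), Matrix.trace_mul_cycle (P f) (δ _) (U _)]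
    ring

/-! ### First variation of the action -/

namespace LocalLagrangian

variable (𝓛 : LocalLagrangian M n)

theorem re_trace_derivField (U : M.Cochain 1 n) (e : M.Cell 1) (w : CMat n) :
    (Matrix.trace (𝓛.derivField U e * w)).re
      = fderiv ℝ (𝓛.density (maxV e)) (fun e' => U e'.1, fun f' => curvature U f'.1)
        (Pi.single ⟨e, rfl⟩ w, 0) := by
  rw [derivField, ← fderiv_apply_eq_re_trace]
  exact fderiv_comp_update_fst (x := fun e' : {e' : M.Cell 1 // maxV e' = maxV e} => U e'.1)
    (𝓛.differentiable_density _ _) ⟨e, rfl⟩ w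

theorem re_trace_derivCurvature (U : M.Cochain 1 n) (f : M.Cell 2) (w : CMat n) :
    (Matrix.trace (𝓛.derivCurvature U f * w)).re
      = fderiv ℝ (𝓛.density (maxV f)) (fun e' => U e'.1, fun f' => curvature U f'.1)
        (0, Pi.single ⟨f, rfl⟩ w) := by
  rw [derivCurvature, ← fderiv_apply_eq_re_trace]
  exact fderiv_comp_update_snd
    (x := fun f' : {f' : M.Cell 2 // maxV f' = maxV f} => curvature U f'.1)
    (𝓛.differentiable_density _ _) ⟨f, rfl⟩ w

theorem fderiv_density_apply (U δ : M.Cochain 1 n) (Δ : M.Cochain 2 n) (v : V) :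
    fderiv ℝ (𝓛.density v) (fun e' => U e'.1, fun f' => curvature U f'.1)
        (fun e' => δ e'.1, fun f' => Δ f'.1)
      = ∑ e : {e : M.Cell 1 // maxV e = v}, (Matrix.trace (𝓛.derivField U e.1 * δ e.1)).re
        + ∑ f : {f : M.Cell 2 // maxV f = v},
          (Matrix.trace (𝓛.derivCurvature U f.1 * Δ f.1)).re := by
  rw [map_prod_pi_eq_sum]
  congr 1
  · refine Finset.sum_congr rfl fun e _ => ?_
    -- Substituting `maxV e` for `v` matches the index `⟨e, rfl⟩` in `derivField`.
    obtain ⟨e, rfl⟩ := e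
    exact (𝓛.re_trace_derivField U e (δ e)).symm
  · refine Finset.sum_congr rfl fun f _ => ?_
    obtain ⟨f, rfl⟩ := f
    exact (𝓛.re_trace_derivCurvature U f (Δ f)).symm

/-- The gradient of the action with respect to the scalar product `Re Tr (u* v)`. -/
noncomputable def gradient (U : M.Cochain 1 n) : M.Cochain 1 n := fun e =>
  covBoundary (connection U) (adj (𝓛.derivCurvature U)) e + adj (𝓛.derivField U) e

/-- First variation formula: the chain rule at each vertex, then regrouping by maximal vertices and
the adjointness of the covariant boundary. It holds for arbitrary matrix-valued fields; the group
enters only through the admissible δ. -/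
theorem hasDerivAt_action {u : ℝ → M.Cochain 1 n} {δ : M.Cochain 1 n} {t : ℝ}
    (hu : ∀ e, HasDerivAt (fun s => u s e) (δ e) t) :
    HasDerivAt (fun s => 𝓛.action (u s))
      (∑ e, (Matrix.trace ((𝓛.gradient (u t) e)ᴴ * δ e)).re) t := by
  have hv : ∀ v ∈ Finset.univ, HasDerivAt (fun s => 𝓛.toFun (u s) v)
      (∑ e : {e : M.Cell 1 // maxV e = v}, (Matrix.trace (𝓛.derivField (u t) e.1 * δ e.1)).re
        + ∑ f : {f : M.Cell 2 // maxV f = v},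
          (Matrix.trace (𝓛.derivCurvature (u t) f.1 * curvatureVariation (u t) δ f.1)).re) t := by
    intro v _
    rw [← 𝓛.fderiv_density_apply (u t) δ (curvatureVariation (u t) δ) v]
    simp only [𝓛.toFun_eq]
    have h1 : HasDerivAt (fun s => ((fun e' : {e : M.Cell 1 // maxV e = v} => u s e'.1),
        (fun f' : {f : M.Cell 2 // maxV f = v} => curvature (u s) f'.1)))
        (fun e' => δ e'.1, fun f' => curvatureVariation (u t) δ f'.1) t :=
      (hasDerivAt_pi.2 fun e' : {e : M.Cell 1 // maxV e = v} => hu e'.1).prodMk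
        (hasDerivAt_pi.2 fun f' : {f : M.Cell 2 // maxV f = v} => hasDerivAt_curvature hu f'.1)
    exact (𝓛.differentiable_density v _).hasFDerivAt.comp_hasDerivAt t h1
  refine (HasDerivAt.fun_sum hv).congr_deriv ?_
  rw [Finset.sum_add_distrib,
    sum_sum_fiber maxV fun e => (Matrix.trace (𝓛.derivField (u t) e * δ e)).re,
    sum_sum_fiber maxV fun f =>
      (Matrix.trace (𝓛.derivCurvature (u t) f * curvatureVariation (u t) δ f)).re,
    ← Complex.re_sum Finset.univ fun f =>
      Matrix.trace (𝓛.derivCurvature (u t) f * curvatureVariation (u t) δ f),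
    ← sum_trace_covBoundary, Complex.re_sum, ← Finset.sum_add_distrib]
  refine Finset.sum_congr rfl fun e _ => ?_
  rw [gradient, Matrix.conjTranspose_add, Matrix.add_mul, Matrix.trace_add, Complex.add_re,
    add_comm, show (adj (𝓛.derivField (u t)) e)ᴴ = 𝓛.derivField (u t) e from
      Matrix.conjTranspose_conjTranspose _]

end LocalLagrangian

end Spacetime

/-! ### The Euler–Lagrange equation -/

/-- Euler–Lagrange equation for a gauge group field. -/
theorem mainTheorem9
    {V : Type*} [Fintype V] [LinearOrder V] {d : ℕ} (M : Spacetime V d)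
    {E : Type*} [NormedAddCommGroup E] [NormedSpace ℝ E] [FiniteDimensional ℝ E]
    {G : Type*} [TopologicalSpace G] [ChartedSpace E G] [Group G] [LieGroup 𝓘(ℝ, E) ∞ G]
    {n : ℕ} (ρ : G →* Matrix.unitaryGroup (Fin n) ℂ)
    (hρ : ContMDiff 𝓘(ℝ, E) 𝓘(ℝ, CMat n) ∞ (fun g : G => (ρ g : CMat n)))
    (𝓛 : Spacetime.LocalLagrangian M n) (U : M.Cell 1 → G) :
    IsStationaryOn (E := E) ρ 𝓛.action U ↔
      ∀ e : M.Cell 1,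
        orthProj (gaugeTangent (E := E) ρ (U e))
          (Spacetime.covBoundary (Spacetime.connection (gaugeField ρ U))
              (Spacetime.adj (𝓛.derivCurvature (gaugeField ρ U))) e
            + Spacetime.adj (𝓛.derivField (gaugeField ρ U)) e) = 0 := by
  have hM : IsManifold 𝓘(ℝ, E) ∞ G := inferInstance
  have hd : MDifferentiable 𝓘(ℝ, E) 𝓘(ℝ, CMat n) (fun g : G => (ρ g : CMat n)) :=
    hρ.mdifferentiable (by simp)
  simp only [orthProj_eq_zero_iff]
  constructor
  -- Test with a variation that moves `U` at the single edge `e` with velocity `w`; the first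
  -- variation reduces to one summand.
  · rintro hS e w ⟨v, hvw⟩
    obtain ⟨c, hc0, hc, hcv⟩ := exists_contMDiffAt_curve (hd (U e)) v
    have hcd : HasDerivAt (fun t => (ρ (c t) : CMat n)) w 0 := hcv.congr_deriv hvw
    have hγ0 : (fun x => Function.update U e (c 0) x) = U := by
      rw [hc0]; exact Function.update_eq_self e U
    have h := hS (fun t => Function.update U e (c t)) hγ0 fun x => by
      by_cases hx : x = e
      · subst hx; simpa using hc
      · simpa [hx] using contMDiffAt_const
    have h' := 𝓛.hasDerivAt_action (u := fun t => gaugeField ρ (Function.update U e (c t)))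
      (δ := Pi.single e w) (t := 0) fun x => by
          by_cases hx : x = e
          · subst hx; simpa [gaugeField] using hcd
          · simpa [gaugeField, hx] using hasDerivAt_const (0 : ℝ) _
    -- The first variation formula and stationarity give the same derivative, so the sum is 0.
    have h0 := h'.unique h
    rw [Finset.sum_eq_single e (fun x _ hx => by simp [hx]) (by simp)] at h0
    simp only [hγ0, Pi.single_eq_same] at h0
    exact h0
  · intro hP γ hγ0 hγ
    subst hγ0
    -- The edge velocities of any admissible variation are tangent to the group, so every summand
    -- vanishes by orthogonality.
    choose v hv using fun x => exists_hasDerivAt_comp_curve (hd (γ 0 x))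
      ((hγ x).mdifferentiableAt (by simp))
    refine (𝓛.hasDerivAt_action (u := fun t => gaugeField ρ (γ t)) hv).congr_deriv ?_
    exact Finset.sum_eq_zero fun e _ => hP e _ ⟨v e, rfl⟩
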